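/- There is a universal constant $K>0$ with the following property. Let $G=(V,E)$ be a finite connected graph without loops or parallel edges, with $n=|V|\geq 2$ vertices, and let $d_x$ be the degree of $x\in V$ and $d_{\min}=\min_{x\in V}d_x$. Let $P$ be the transition matrix of lazy random walk on $G$, that is, $P(x,x)=\frac12$, $P(x,y)=\frac{1}{2d_x}$ if $xy\in E$, and $P(x,y)=0$ otherwise. Its eigenvalues are real; list them with multiplicity as $1=\lambda_1>\lambda_2\geq\dots\geq\lambda_n\geq 0$, and let $t_{\mathrm{rel}}=(1-\lambda_2)^{-1}$ be the relaxation time. Place a unit resistance on each edge of $G$, and for $x,y\in V$ let $R_{\mathrm{eff}}(x\leftrightarrow y)$ be the effective resistance between $x$ and $y$, that is, $W(x)-W(y)$ for any voltage $W:V\to\mathbb{R}$ that drives a unit current from $x$ to $y$: $\sum_{v\,:\,uv\in E}(W(u)-W(v))=\mathbf 1_{\{u=x\}}-\mathbf 1_{\{u=y\}}$ for all $u\in V$. Then, for all $x,y\in V$, \[R_{\mathrm{eff}}(x\leftrightarrow y)\leq \frac{K\,\sqrt{t_{\mathrm{rel}}}}{d_{\min}}.\] -/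

import Mathlib

namespace LazyWalk

variable {V : Type*} [Fintype V] [DecidableEq V] (G : SimpleGraph V) [DecidableRel G.Adj]

/-- Transition matrix of lazy random walk on `G`. -/
noncomputable def transition : Matrix V V ℝ :=
  Matrix.of fun x y =>
    if y = x then 1 / 2 else if G.Adj x y then 1 / (2 * (G.degree x : ℝ)) else 0

/-- The eigenvalues of the lazy walk, repeated according to (algebraic) multiplicity and listed in
nonincreasing order, `λ₁ ≥ λ₂ ≥ …`. The transition matrix of a connected graph on `n ≥ 2` vertices
is similar to a symmetric one, so it has `n` real eigenvalues and the list has length `n`. -/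
noncomputable def eigenvalueList : List ℝ :=
  (transition G).charpoly.roots.sort (· ≥ ·)

/-- The second largest eigenvalue `λ₂`, counted with multiplicity: the entry at index `1` (indices
start at `0`). The default value `0` is used only if there are fewer than two eigenvalues, which
does not happen for connected graphs with at least two vertices. -/
noncomputable def secondEigenvalue : ℝ :=
  (eigenvalueList G).getD 1 0

/-- The relaxation time `t_rel = (1 - λ₂)⁻¹` of the lazy walk. -/
noncomputable def relaxationTime : ℝ :=
  (1 - secondEigenvalue G)⁻¹

/-- `W` is a voltage on the network `G` with unit resistances when a unit current enters at `x` and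
leaves at `y`: by Ohm's law the current along an edge from `u` to `v` is `W u - W v`, and by
Kirchhoff's node law the net current out of `u` is `1` at `x`, `-1` at `y`, and `0` elsewhere
(and `0` everywhere if `x = y`). -/
def IsUnitCurrentVoltage (x y : V) (W : V → ℝ) : Prop :=
  ∀ u : V, ∑ v ∈ G.neighborFinset u, (W u - W v) =
    (if u = x then 1 else 0) - (if u = y then 1 else 0)

variable {G}

theorem isUnitCurrentVoltage_iff {x y : V} {W : V → ℝ} :
    IsUnitCurrentVoltage G x y W ↔
      (G.lapMatrix ℝ).mulVec W = Pi.single x 1 - Pi.single y 1 := by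
  rw [funext_iff]
  refine forall_congr' fun u => ?_
  rw [SimpleGraph.lapMatrix_mulVec_apply]
  simp [Finset.sum_sub_distrib, Pi.single_apply]

/-- In a connected network a unit current voltage exists between any two vertices. -/
theorem exists_isUnitCurrentVoltage (hG : G.Connected) (x y : V) :
    ∃ W : V → ℝ, IsUnitCurrentVoltage G x y W := by
  classical
  let L : (V → ℝ) →ₗ[ℝ] (V → ℝ) := Matrix.toLin' (G.lapMatrix ℝ)
  let S : (V → ℝ) →ₗ[ℝ] ℝ := ∑ i, LinearMap.proj i
  have hS : ∀ f, S f = ∑ i, f i := fun f => by simp [S]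
  have hle : LinearMap.range L ≤ LinearMap.ker S := by
    rintro _ ⟨f, rfl⟩
    rw [LinearMap.mem_ker, hS]
    have h1 : ∑ i, L f i = (fun _ => (1 : ℝ)) ⬝ᵥ (G.lapMatrix ℝ).mulVec f := by
      simp [L, dotProduct]
    rw [h1, Matrix.dotProduct_mulVec, ← Matrix.mulVec_transpose, (G.isSymm_lapMatrix (R := ℝ)).eq,
      SimpleGraph.lapMatrix_mulVec_const_eq_zero, zero_dotProduct]
  have hkerL : Module.finrank ℝ (LinearMap.ker L) = 1 := by
    rw [← SimpleGraph.card_connectedComponent_eq_finrank_ker_toLin'_lapMatrix]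
    have := hG.preconnected.subsingleton_connectedComponent
    have : Nonempty G.ConnectedComponent := ⟨G.connectedComponentMk x⟩
    exact Fintype.card_eq_one_iff_nonempty_unique.2 ⟨⟨⟨Classical.arbitrary _⟩,
      fun _ => Subsingleton.elim _ _⟩⟩
  have hrangeS : Module.finrank ℝ (LinearMap.range S) = 1 := by
    have : LinearMap.range S = ⊤ := by
      rw [LinearMap.range_eq_top]
      intro c
      exact ⟨Pi.single x c, by simp [hS]⟩
    rw [this]
    simp
  have e1 := L.finrank_range_add_finrank_ker
  have e2 := S.finrank_range_add_finrank_ker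
  have heq := Submodule.eq_of_le_of_finrank_eq hle (by omega)
  have hmem : (Pi.single x 1 - Pi.single y 1 : V → ℝ) ∈ LinearMap.range L := by
    rw [heq, LinearMap.mem_ker, hS]
    simp
  obtain ⟨W, hW⟩ := hmem
  exact ⟨W, isUnitCurrentVoltage_iff.2 (by simpa [L] using hW)⟩

/-- Effective resistance between `x` and `y` with unit resistances on the edges: the voltage drop
from `x` to `y` that drives a unit current from `x` to `y`. -/
noncomputable def effectiveResistance (hG : G.Connected) (x y : V) : ℝ :=
  (exists_isUnitCurrentVoltage hG x y).choose x - (exists_isUnitCurrentVoltage hG x y).choose y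

/-- The effective resistance does not depend on the choice of the voltage. -/
theorem effectiveResistance_eq (hG : G.Connected) {x y : V} {W : V → ℝ}
    (hW : IsUnitCurrentVoltage G x y W) : effectiveResistance hG x y = W x - W y := by
  have h := (exists_isUnitCurrentVoltage hG x y).choose_spec
  rw [effectiveResistance]
  generalize (exists_isUnitCurrentVoltage hG x y).choose = U at h
  have h0 : (G.lapMatrix ℝ).mulVec (U - W) = 0 := by
    rw [Matrix.mulVec_sub, isUnitCurrentVoltage_iff.1 h, isUnitCurrentVoltage_iff.1 hW, sub_self]
  have := (SimpleGraph.lapMatrix_mulVec_eq_zero_iff_forall_reachable G).1 h0 x y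
    (hG.preconnected x y)
  simp only [Pi.sub_apply] at this
  linarith

end LazyWalk

/-! Let `W` drive a unit current from `x` to `y`, put `R = W x - W y`, `r = R / 4`, `δ = d_min`.
Replacing `W` by `-W` if necessary, the vertices above the middle level carry at most half of the
volume. Clamping `W` between the middle level and `W x - r` gives a function that is `0` on the
lower part, rises to `r` on `A = {W ≥ W x - r}`, and has energy at most `2 * r` (`energy_comp_le`).
The Poincaré inequality `poincare_two_sets` then gives `volume A * r ≤ t_rel`.

It remains to bound the volume of `A` below by a multiple of `r * δ ^ 2` (`le_volume`). For `r < 1`,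
few neighbours of `x` can lie outside `A`, since the unit current leaving `x` is shared among them.
For `r ≥ 1`, voltage is 1-Lipschitz in graph distance, so `A` contains a ball, which has about `r *
δ / 3` vertices. Hence `(r * δ) ^ 2 ≤ 6 * t_rel`. -/

/-! ### Spectral bound for a symmetric contraction -/

open Matrix in
/-- A positive semidefinite contraction whose fixed vectors are the multiples of `e` has second
eigenvalue in `[0, 1)`, and this eigenvalue bounds its quadratic form orthogonally to `e`. -/
theorem Matrix.PosSemidef.second_eigenvalue_bound {n : Type*} [Fintype n] [DecidableEq n]
    [Nontrivial n] {A : Matrix n n ℝ} (hA : A.PosSemidef) {e : n → ℝ} (he : e ≠ 0)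
    (hAe : A *ᵥ e = e) (hle : ∀ v, v ⬝ᵥ A *ᵥ v ≤ v ⬝ᵥ v)
    (hfix : ∀ v, A *ᵥ v = v → ∃ c : ℝ, v = c • e) :
    0 ≤ (A.charpoly.roots.sort (· ≥ ·)).getD 1 0 ∧
      (A.charpoly.roots.sort (· ≥ ·)).getD 1 0 < 1 ∧
      ∀ g, g ⬝ᵥ e = 0 →
        g ⬝ᵥ A *ᵥ g ≤ (A.charpoly.roots.sort (· ≥ ·)).getD 1 0 * (g ⬝ᵥ g) := by
  have hH := hA.isHermitian
  have hcard : 1 < Fintype.card n := Fintype.one_lt_card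
  let E : Fin (Fintype.card n) ≃ n := Fintype.equivOfCardEq (Fintype.card_fin _)
  let u : n → n → ℝ := fun i => (hH.eigenvectorBasis i).ofLp
  let μ := hH.eigenvalues
  have hu : ∀ i, A *ᵥ u i = μ i • u i := hH.mulVec_eigenvectorBasis
  have hinner : ∀ f g : n → ℝ, f ⬝ᵥ g = inner ℝ (WithLp.toLp 2 f) (WithLp.toLp 2 g) := by
    intro f g
    rw [EuclideanSpace.inner_eq_star_dotProduct, star_trivial, dotProduct_comm]
  have horth : ∀ i j, u i ⬝ᵥ u j = if i = j then 1 else 0 := by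
    intro i j
    rw [hinner]
    exact orthonormal_iff_ite.1 hH.eigenvectorBasis.orthonormal i j
  have hexp : ∀ f g : n → ℝ, f ⬝ᵥ g = ∑ i, (f ⬝ᵥ u i) * (u i ⬝ᵥ g) := by
    intro f g
    simp only [hinner]
    exact (hH.eigenvectorBasis.sum_inner_mul_inner (WithLp.toLp 2 f) (WithLp.toLp 2 g)).symm
  have hsymm : ∀ f g, f ⬝ᵥ A *ᵥ g = (A *ᵥ f) ⬝ᵥ g := by
    intro f g
    rw [dotProduct_mulVec, ← mulVec_transpose]
    congr 2
  have hlist : A.charpoly.roots.sort (· ≥ ·) = List.ofFn hH.eigenvalues₀ := by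
    rw [← hH.sort_roots_charpoly_eq_eigenvalues₀]
    simp
  have hsecond : (A.charpoly.roots.sort (· ≥ ·)).getD 1 0 = hH.eigenvalues₀ ⟨1, hcard⟩ := by
    rw [hlist, List.getD_eq_getElem _ _ (by simpa using hcard)]
    simp
  have hμ : ∀ k, μ (E k) = hH.eigenvalues₀ k := by
    intro k
    simp [μ, Matrix.IsHermitian.eigenvalues, E]
  have hμle : ∀ i, μ i ≤ 1 := by
    intro i
    have := hle (u i)
    simpa [hu, horth] using this
  -- Otherwise the fixed vector `e` would be orthogonal to every eigenvector.
  have hone : ∃ i, μ i = 1 := by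
    by_contra! h
    apply he
    have hz : ∀ i, e ⬝ᵥ u i = 0 := by
      intro i
      have h1 : e ⬝ᵥ A *ᵥ u i = e ⬝ᵥ u i := by rw [hsymm, hAe]
      rw [hu, dotProduct_smul, smul_eq_mul] at h1
      have h2 : (μ i - 1) * (e ⬝ᵥ u i) = 0 := by linarith
      exact (mul_eq_zero.1 h2).resolve_left (sub_ne_zero.2 (h i))
    have := hexp e e
    simp only [hz, zero_mul, Finset.sum_const_zero] at this
    exact dotProduct_self_eq_zero.1 this
  have hprop : ∀ i, μ i = 1 → ∃ c : ℝ, u i = c • e := by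
    intro i hi
    apply hfix
    rw [hu, hi, one_smul]
  -- Two orthonormal vectors cannot both be multiples of `e`.
  have huniq : ∀ i j, μ i = 1 → μ j = 1 → i = j := by
    intro i j hi hj
    by_contra hij
    obtain ⟨c, hc⟩ := hprop i hi
    obtain ⟨d, hd⟩ := hprop j hj
    have h1 := horth i i
    have h2 := horth j j
    have h3 := horth i j
    rw [hc] at h1
    rw [hd] at h2
    rw [hc, hd, if_neg hij] at h3
    simp only [smul_dotProduct, dotProduct_smul, smul_eq_mul, if_true] at h1 h2 h3
    have : (c * (c * (e ⬝ᵥ e))) * (d * (d * (e ⬝ᵥ e))) =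
        c * (d * (e ⬝ᵥ e)) * (c * (d * (e ⬝ᵥ e))) := by ring
    rw [h1, h2] at this
    have h4 : c * (d * (e ⬝ᵥ e)) = 0 := by first | exact h3 | linarith
    rw [h4] at this
    norm_num at this
  let z : Fin (Fintype.card n) := ⟨0, by omega⟩
  have hz : μ (E z) = 1 := by
    obtain ⟨i, hi⟩ := hone
    refine le_antisymm (hμle _) ?_
    rw [← hi, ← E.apply_symm_apply i, hμ, hμ]
    exact hH.eigenvalues₀_antitone (Fin.mk_le_mk.2 (Nat.zero_le _))
  have hlt : hH.eigenvalues₀ ⟨1, hcard⟩ < 1 := by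
    rw [← hμ]
    refine lt_of_le_of_ne (hμle _) fun h => ?_
    have := E.injective (huniq _ _ h hz)
    simp [z] at this
  have hother : ∀ i, i ≠ E z → μ i ≤ hH.eigenvalues₀ ⟨1, hcard⟩ := by
    intro i hi
    rw [← E.apply_symm_apply i, hμ]
    apply hH.eigenvalues₀_antitone
    rw [Fin.le_def]
    have : E.symm i ≠ z := fun h => hi (by rw [← h, E.apply_symm_apply])
    have h2 : (E.symm i : ℕ) ≠ 0 := fun h => this (Fin.ext h)
    exact Nat.one_le_iff_ne_zero.2 h2
  rw [hsecond]
  refine ⟨?_, hlt, fun g hg => ?_⟩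
  · rw [← hμ]
    exact hA.eigenvalues_nonneg _
  · rw [hexp g g, hexp g (A *ᵥ g), Finset.mul_sum]
    refine Finset.sum_le_sum fun i _ => ?_
    have h1 : u i ⬝ᵥ A *ᵥ g = μ i * (g ⬝ᵥ u i) := by
      rw [hsymm, hu, smul_dotProduct, smul_eq_mul, dotProduct_comm]
    rw [h1, dotProduct_comm (u i) g]
    by_cases hi : i = E z
    · obtain ⟨c, hc⟩ := hprop i (hi ▸ hz)
      have : g ⬝ᵥ u i = 0 := by rw [hc, dotProduct_smul, hg, smul_zero]
      simp [this]
    · nlinarith [hother i hi, mul_self_nonneg (g ⬝ᵥ u i)]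

/-! ### Dirichlet energy and Poincaré inequalities -/

namespace LazyWalk

open Matrix

variable {V : Type*} [Fintype V] (G : SimpleGraph V) [DecidableRel G.Adj]

/-- The sum of `(f u - f v) ^ 2` over all ordered pairs of adjacent vertices. -/
def energy (f : V → ℝ) : ℝ :=
  ∑ u, ∑ v, if G.Adj u v then (f u - f v) ^ 2 else 0

/-- The sum of the degrees of the vertices in a set. -/
noncomputable def volume (A : Set V) : ℝ :=
  open Classical in ∑ v, if v ∈ A then (G.degree v : ℝ) else 0

variable {G}

theorem energy_nonneg (f : V → ℝ) : 0 ≤ energy G f :=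
  Finset.sum_nonneg fun u _ => Finset.sum_nonneg fun v _ => by split_ifs <;> positivity

/-- Summation by parts. -/
theorem sum_mul_sum_neighbor_sub (f g : V → ℝ) :
    ∑ u, g u * ∑ v ∈ G.neighborFinset u, (f u - f v) =
      (∑ u, ∑ v, if G.Adj u v then (g u - g v) * (f u - f v) else 0) / 2 := by
  have h1 : ∑ u, g u * ∑ v ∈ G.neighborFinset u, (f u - f v) =
      ∑ u, ∑ v, if G.Adj u v then g u * (f u - f v) else 0 := by
    refine Finset.sum_congr rfl fun u _ => ?_
    rw [Finset.mul_sum, ← Finset.sum_filter]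
    exact Finset.sum_congr (by ext; simp) fun _ _ => rfl
  have h2 : ∑ u, g u * ∑ v ∈ G.neighborFinset u, (f u - f v) =
      ∑ u, ∑ v, if G.Adj u v then g v * (f v - f u) else 0 := by
    rw [h1, Finset.sum_comm]
    simp only [G.adj_comm]
  rw [eq_div_iff two_ne_zero, mul_two]
  nth_rewrite 1 [h1]
  rw [h2, ← Finset.sum_add_distrib]
  refine Finset.sum_congr rfl fun u _ => ?_
  rw [← Finset.sum_add_distrib]
  refine Finset.sum_congr rfl fun v _ => ?_
  split_ifs <;> ring

theorem sum_mul_sum_neighbor_sub_self (f : V → ℝ) :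
    ∑ u, f u * ∑ v ∈ G.neighborFinset u, (f u - f v) = energy G f / 2 := by
  rw [sum_mul_sum_neighbor_sub, energy]
  simp only [sq]

/-- By `(a - b) ^ 2 ≤ 2 * a ^ 2 + 2 * b ^ 2`. Because of laziness this is exactly positive
semidefiniteness of the walk. -/
theorem energy_le (f : V → ℝ) : energy G f ≤ 4 * ∑ u, (G.degree u : ℝ) * f u ^ 2 := by
  have h1 : ∑ u, (G.degree u : ℝ) * f u ^ 2 = ∑ u, ∑ v, if G.Adj u v then f u ^ 2 else 0 := by
    refine Finset.sum_congr rfl fun u _ => ?_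
    rw [G.degree_eq_sum_if_adj, Finset.sum_mul]
    simp
  have h2 : ∑ u, (G.degree u : ℝ) * f u ^ 2 = ∑ u, ∑ v, if G.Adj u v then f v ^ 2 else 0 := by
    rw [h1, Finset.sum_comm]
    simp only [G.adj_comm]
  have h3 : 4 * ∑ u, (G.degree u : ℝ) * f u ^ 2 =
      ∑ u, ∑ v, if G.Adj u v then 2 * f u ^ 2 + 2 * f v ^ 2 else 0 := by
    have : (4 : ℝ) * ∑ u, (G.degree u : ℝ) * f u ^ 2 =
      2 * (∑ u, (G.degree u : ℝ) * f u ^ 2) + 2 * ∑ u, (G.degree u : ℝ) * f u ^ 2 := by ring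
    rw [this]
    nth_rewrite 1 [h1]
    rw [h2, Finset.mul_sum, Finset.mul_sum, ← Finset.sum_add_distrib]
    refine Finset.sum_congr rfl fun u _ => ?_
    rw [Finset.mul_sum, Finset.mul_sum, ← Finset.sum_add_distrib]
    refine Finset.sum_congr rfl fun v _ => ?_
    split_ifs <;> ring
  rw [h3]
  refine Finset.sum_le_sum fun u _ => Finset.sum_le_sum fun v _ => ?_
  split_ifs
  · nlinarith [sq_nonneg (f u + f v)]
  · rfl

theorem energy_sub_const (f : V → ℝ) (c : ℝ) : energy G (fun u => f u - c) = energy G f := by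
  simp only [energy, sub_sub_sub_cancel_right]

theorem degree_pos (hG : G.Connected) [Nontrivial V] (u : V) : (0 : ℝ) < G.degree u := by
  exact_mod_cast hG.preconnected.degree_pos_of_nontrivial u

variable [DecidableEq V]

/-- The factor `2` appears because the energy counts each edge in both orders. -/
theorem sq_sub_le_energy (f : V → ℝ) {u v : V} (h : G.Adj u v) :
    2 * (f u - f v) ^ 2 ≤ energy G f := by
  have hrow : ∀ a b, G.Adj a b →
      (f a - f b) ^ 2 ≤ ∑ w, if G.Adj a w then (f a - f w) ^ 2 else 0 := by
    intro a b hab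
    have := Finset.single_le_sum (f := fun w => if G.Adj a w then (f a - f w) ^ 2 else 0)
      (fun w _ => by split_ifs <;> positivity) (Finset.mem_univ b)
    simpa [hab] using this
  have hpair := Finset.sum_le_sum_of_subset_of_nonneg
    (f := fun a => ∑ w, if G.Adj a w then (f a - f w) ^ 2 else 0) (Finset.subset_univ {u, v})
    fun a _ _ => Finset.sum_nonneg fun w _ => by split_ifs <;> positivity
  rw [Finset.sum_pair h.ne] at hpair
  have h1 := hrow u v h
  have h2 := hrow v u h.symm
  unfold energy
  nlinarith

theorem eq_of_energy_eq_zero (hG : G.Connected) {f : V → ℝ} (h : energy G f = 0) (u v : V) :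
    f u = f v := by
  refine (SimpleGraph.lapMatrix_toLinearMap₂'_apply'_eq_zero_iff_forall_reachable G f).1 ?_ u v
    (hG.preconnected u v)
  rw [SimpleGraph.lapMatrix_toLinearMap₂']
  change energy G f / 2 = 0
  rw [h, zero_div]

theorem transition_mulVec (f : V → ℝ) (u : V) (hu : (0 : ℝ) < G.degree u) :
    (transition G *ᵥ f) u =
      f u - (∑ v ∈ G.neighborFinset u, (f u - f v)) / (2 * (G.degree u : ℝ)) := by
  have h1 : (transition G *ᵥ f) u =
      ∑ v, ((if v = u then f v / 2 else 0) +
        if G.Adj u v then f v / (2 * (G.degree u : ℝ)) else 0) := by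
    simp only [mulVec, dotProduct, transition, Matrix.of_apply]
    refine Finset.sum_congr rfl fun v _ => ?_
    by_cases h : v = u
    · subst h
      simp
      ring
    · simp only [h, if_false]
      split_ifs <;> ring
  rw [h1, Finset.sum_add_distrib, Finset.sum_ite_eq' Finset.univ u, if_pos (Finset.mem_univ _),
    ← Finset.sum_filter, ← G.neighborFinset_eq_filter, Finset.sum_sub_distrib, ← Finset.sum_div]
  simp only [Finset.sum_const, SimpleGraph.card_neighborFinset_eq_degree, nsmul_eq_mul]
  field_simp
  ring

theorem sum_degree_mul_transition_mulVec (hG : G.Connected) [Nontrivial V] (f : V → ℝ) :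
    ∑ u, (G.degree u : ℝ) * f u * (transition G *ᵥ f) u =
      ∑ u, (G.degree u : ℝ) * f u ^ 2 - energy G f / 4 := by
  have h : energy G f / 4 = (∑ u, f u * ∑ v ∈ G.neighborFinset u, (f u - f v)) / 2 := by
    rw [sum_mul_sum_neighbor_sub_self]
    ring
  rw [h, Finset.sum_div, ← Finset.sum_sub_distrib]
  refine Finset.sum_congr rfl fun u _ => ?_
  have := degree_pos hG u
  rw [transition_mulVec f u this]
  field_simp

variable (G)

/-- The symmetric matrix `D^{1/2} P D^{-1/2}` similar to the transition matrix `P`, where `D` is the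
diagonal matrix of degrees. -/
noncomputable def symmTransition : Matrix V V ℝ :=
  diagonal (fun u => √(G.degree u)) * transition G * diagonal (fun u => (√(G.degree u))⁻¹)

variable {G}

theorem symmTransition_mulVec (hG : G.Connected) [Nontrivial V] (f : V → ℝ) :
    symmTransition G *ᵥ (fun u => √(G.degree u) * f u) =
      fun u => √(G.degree u) * (transition G *ᵥ f) u := by
  have h : diagonal (fun u => (√(G.degree u))⁻¹) *ᵥ (fun u => √(G.degree u) * f u) = f := by
    ext u
    have := Real.sqrt_pos.2 (degree_pos hG u)
    rw [mulVec_diagonal]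
    field_simp
  rw [symmTransition, ← mulVec_mulVec, h, ← mulVec_mulVec]
  ext u
  rw [mulVec_diagonal]

theorem charpoly_symmTransition (hG : G.Connected) [Nontrivial V] :
    (symmTransition G).charpoly = (transition G).charpoly := by
  rw [symmTransition, charpoly_mul_comm, ← mul_assoc, diagonal_mul_diagonal]
  have : (fun u => (√(G.degree u : ℝ))⁻¹ * √(G.degree u)) = 1 := by
    ext u
    exact inv_mul_cancel₀ (Real.sqrt_pos.2 (degree_pos hG u)).ne'
  rw [this]
  simp

theorem isHermitian_symmTransition (hG : G.Connected) [Nontrivial V] :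
    (symmTransition G).IsHermitian := by
  ext u v
  simp only [symmTransition, conjTranspose_apply, mul_diagonal, diagonal_mul, transition,
    Matrix.of_apply, star_trivial]
  by_cases h : u = v
  · subst h
    rfl
  · have hu := Real.sqrt_pos.2 (degree_pos hG u)
    have hv := Real.sqrt_pos.2 (degree_pos hG v)
    have hu2 := Real.sq_sqrt (degree_pos hG u).le
    have hv2 := Real.sq_sqrt (degree_pos hG v).le
    simp only [h, Ne.symm h, if_false, G.adj_comm v u]
    split_ifs
    · nth_rewrite 2 [← hv2]
      nth_rewrite 3 [← hu2]
      field_simp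
    · simp

/-- The spectral gap is positive and at most `1`, and it gives a Poincaré inequality. -/
theorem poincare_of_sum_eq_zero (hG : G.Connected) [Nontrivial V] :
    0 ≤ secondEigenvalue G ∧ secondEigenvalue G < 1 ∧
      ∀ f : V → ℝ, ∑ u, (G.degree u : ℝ) * f u = 0 →
        4 * (1 - secondEigenvalue G) * ∑ u, (G.degree u : ℝ) * f u ^ 2 ≤ energy G f := by
  have hspos : ∀ u, 0 < √(G.degree u : ℝ) := fun u => Real.sqrt_pos.2 (degree_pos hG u)
  have hs2 : ∀ u, √(G.degree u : ℝ) * √(G.degree u : ℝ) = G.degree u := fun u =>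
    Real.mul_self_sqrt (degree_pos hG u).le
  have hrep : ∀ g : V → ℝ, ∃ f : V → ℝ, g = fun u => √(G.degree u) * f u := fun g =>
    ⟨fun u => g u / √(G.degree u), by ext u; rw [mul_div_cancel₀ _ (hspos u).ne']⟩
  have hdot : ∀ f g : V → ℝ, (fun u => √(G.degree u) * f u) ⬝ᵥ (fun u => √(G.degree u) * g u) =
      ∑ u, (G.degree u : ℝ) * f u * g u := by
    intro f g
    refine Finset.sum_congr rfl fun u _ => ?_
    rw [← hs2]
    ring
  have hsq : ∀ f : V → ℝ, ∑ u, (G.degree u : ℝ) * f u * f u = ∑ u, (G.degree u : ℝ) * f u ^ 2 :=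
    fun f => Finset.sum_congr rfl fun u _ => by ring
  have hquad : ∀ f : V → ℝ, (fun u => √(G.degree u) * f u) ⬝ᵥ
      symmTransition G *ᵥ (fun u => √(G.degree u) * f u) =
      ∑ u, (G.degree u : ℝ) * f u ^ 2 - energy G f / 4 := by
    intro f
    rw [symmTransition_mulVec hG, hdot, sum_degree_mul_transition_mulVec hG]
  have hpsd : (symmTransition G).PosSemidef := by
    refine .of_dotProduct_mulVec_nonneg (isHermitian_symmTransition hG) fun g => ?_
    obtain ⟨f, rfl⟩ := hrep g
    rw [star_trivial, hquad]
    have := energy_le (G := G) f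
    linarith
  have key := hpsd.second_eigenvalue_bound (e := fun u => √(G.degree u) * 1) ?_ ?_ ?_ ?_
  · rw [charpoly_symmTransition hG] at key
    obtain ⟨h0, h1, h2⟩ := key
    refine ⟨h0, h1, fun f hf => ?_⟩
    have := h2 (fun u => √(G.degree u) * f u) (by rw [hdot]; simpa using hf)
    rw [hquad, hdot, hsq] at this
    change _ ≤ secondEigenvalue G * _ at this
    linarith
  · obtain ⟨u⟩ := (inferInstance : Nonempty V)
    intro h
    have := congrFun h u
    simp only [mul_one, Pi.zero_apply] at this
    exact (hspos u).ne' this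
  · rw [symmTransition_mulVec hG]
    ext u
    rw [transition_mulVec _ u (degree_pos hG u)]
    simp
  · intro g
    obtain ⟨f, rfl⟩ := hrep g
    rw [hquad, hdot, hsq]
    have := energy_nonneg (G := G) f
    linarith
  · intro g hg
    obtain ⟨f, rfl⟩ := hrep g
    have h := hquad f
    rw [hg, hdot, hsq] at h
    obtain ⟨w⟩ := (inferInstance : Nonempty V)
    refine ⟨f w, ?_⟩
    ext u
    rw [Pi.smul_apply, smul_eq_mul, eq_of_energy_eq_zero hG (f := f) (by linarith) u w]
    ring

/-- Poincaré inequality for a function that is nonpositive on a set `B` and at least `h` on a set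
`A` of smaller volume. -/
theorem poincare_two_sets (hG : G.Connected) [Nontrivial V] {f : V → ℝ} {A B : Set V} {h : ℝ}
    (hh : 0 < h) (hA : ∀ u ∈ A, h ≤ f u) (hB : ∀ u ∈ B, f u ≤ 0)
    (hAB : volume G A ≤ volume G B) :
    2 * (1 - secondEigenvalue G) * volume G A * h ^ 2 ≤ energy G f := by
  classical
  obtain ⟨-, hlt, hP⟩ := poincare_of_sum_eq_zero hG
  set D := ∑ u, (G.degree u : ℝ) with hD
  have hDpos : 0 < D := Finset.sum_pos (fun u _ => degree_pos hG u) Finset.univ_nonempty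
  set c := (∑ u, (G.degree u : ℝ) * f u) / D with hc
  have hmean : ∑ u, (G.degree u : ℝ) * (f u - c) = 0 := by
    simp only [mul_sub, Finset.sum_sub_distrib, ← Finset.sum_mul]
    rw [← hD, hc, mul_div_cancel₀ _ hDpos.ne', sub_self]
  have h1 := hP _ hmean
  rw [energy_sub_const] at h1
  have hA0 : 0 ≤ volume G A := Finset.sum_nonneg fun u _ => by split_ifs <;> positivity
  have h2 : volume G A * h ^ 2 / 2 ≤ ∑ u, (G.degree u : ℝ) * (f u - c) ^ 2 := by
    have hterm : volume G A * (max (h - c) 0) ^ 2 + volume G B * (max c 0) ^ 2 ≤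
        ∑ u, (G.degree u : ℝ) * (f u - c) ^ 2 := by
      rw [volume, volume, Finset.sum_mul, Finset.sum_mul, ← Finset.sum_add_distrib]
      refine Finset.sum_le_sum fun u _ => ?_
      have hd := (degree_pos hG u).le
      have hm : ∀ t : ℝ, 0 ≤ max t 0 := fun t => le_max_right _ _
      by_cases hu : u ∈ A
      · have huB : u ∉ B := fun h' => by linarith [hA u hu, hB u h']
        simp only [hu, huB, if_true, if_false, zero_mul, add_zero]
        refine mul_le_mul_of_nonneg_left ?_ hd
        rcases le_total (h - c) 0 with h' | h'
        · rw [max_eq_right h', zero_pow two_ne_zero]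
          positivity
        · rw [max_eq_left h']
          nlinarith [hA u hu]
      · simp only [hu, if_false, zero_mul, zero_add]
        by_cases huB : u ∈ B
        · simp only [huB, if_true]
          refine mul_le_mul_of_nonneg_left ?_ hd
          rcases le_total c 0 with h' | h'
          · rw [max_eq_right h', zero_pow two_ne_zero]
            positivity
          · rw [max_eq_left h']
            nlinarith [hB u huB]
        · simp only [huB, if_false, zero_mul]
          positivity
    have h3 : volume G A * ((max (h - c) 0) ^ 2 + (max c 0) ^ 2) ≤
        ∑ u, (G.degree u : ℝ) * (f u - c) ^ 2 := by
      nlinarith [sq_nonneg (max c 0)]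
    -- The two truncated distances to the mean `c` add up to at least `h`.
    have h4 : h ^ 2 / 2 ≤ (max (h - c) 0) ^ 2 + (max c 0) ^ 2 := by
      have a := le_max_left (h - c) 0
      have b := le_max_left c 0
      nlinarith [sq_nonneg (max (h - c) 0 - max c 0)]
    nlinarith
  nlinarith

end LazyWalk

/-! ### Volume growth of balls -/

namespace LazyWalk

/-- In a connected graph, every distance from `x` up to `dist x y` is attained. -/
theorem exists_dist_eq {V : Type*} {G : SimpleGraph V} (hG : G.Connected) (x y : V)
    {k : ℕ} (hk : k ≤ G.dist x y) :
    ∃ v, G.dist x v = k := by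
  obtain ⟨p, hp⟩ := hG.exists_walk_length_eq_dist x y
  refine ⟨p.getVert k, le_antisymm ?_ ?_⟩
  · exact (SimpleGraph.dist_le (p.take k)).trans (by simp)
  · have h1 := hG.dist_triangle (u := x) (v := p.getVert k) (w := y)
    have h2 := SimpleGraph.dist_le (p.drop k)
    rw [SimpleGraph.Walk.drop_length] at h2
    omega

variable {V : Type*} [Fintype V] {G : SimpleGraph V} [DecidableRel G.Adj]

theorem volume_mono {A B : Set V} (h : A ⊆ B) : volume G A ≤ volume G B := by
  classical
  refine Finset.sum_le_sum fun u _ => ?_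
  by_cases hA : u ∈ A
  · simp [hA, h hA]
  · simp only [hA, if_false]
    split_ifs <;> positivity

theorem card_mul_minDegree_le_volume {A : Set V} (S : Finset V) (h : ∀ u ∈ S, u ∈ A) :
    (S.card : ℝ) * G.minDegree ≤ volume G A := by
  classical
  have h1 : ∑ u ∈ S, (if u ∈ A then (G.degree u : ℝ) else 0) ≤ volume G A :=
    Finset.sum_le_sum_of_subset_of_nonneg (Finset.subset_univ S)
      fun u _ _ => by split_ifs <;> positivity
  refine le_trans ?_ h1
  rw [← nsmul_eq_mul]
  refine Finset.card_nsmul_le_sum _ _ _ fun u hu => ?_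
  rw [if_pos (h u hu)]
  exact_mod_cast G.minDegree_le_degree u

/-- The ball of radius `3 * j + 1` contains `j + 1` disjoint neighbourhoods, if it is not the whole
graph. -/
theorem exists_finset_dist_le (hG : G.Connected) {x y : V} (j : ℕ) (hj : 3 * j ≤ G.dist x y) :
    ∃ S : Finset V, (∀ u ∈ S, G.dist x u ≤ 3 * j + 1) ∧ (j + 1) * G.minDegree ≤ S.card := by
  classical
  have hex : ∀ i, ∃ v, i ≤ j → G.dist x v = 3 * i := by
    intro i
    by_cases hi : i ≤ j
    · obtain ⟨v, hv⟩ := exists_dist_eq hG x y (k := 3 * i) (by omega)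
      exact ⟨v, fun _ => hv⟩
    · exact ⟨x, fun h => absurd h hi⟩
  choose v hv using hex
  -- Neighbours of `v i` lie at distance `3 * i - 1` to `3 * i + 1` from `x`; these shells are
  -- disjoint for distinct `i`.
  have hdist : ∀ i ≤ j, ∀ u ∈ G.neighborFinset (v i),
      G.dist x u ≤ 3 * i + 1 ∧ 3 * i ≤ G.dist x u + 1 := by
    intro i hi u hu
    rw [SimpleGraph.mem_neighborFinset] at hu
    have h1 := hu.diff_dist_adj (u := x)
    have h2 := hv i hi
    omega
  refine ⟨(Finset.range (j + 1)).biUnion fun i => G.neighborFinset (v i), ?_, ?_⟩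
  · intro u hu
    obtain ⟨i, hi, hu⟩ := Finset.mem_biUnion.1 hu
    rw [Finset.mem_range] at hi
    have := (hdist i (by omega) u hu).1
    omega
  · rw [Finset.card_biUnion]
    · have := Finset.card_nsmul_le_sum (Finset.range (j + 1))
        (fun i => (G.neighborFinset (v i)).card) G.minDegree fun i _ => by
          rw [SimpleGraph.card_neighborFinset_eq_degree]
          exact G.minDegree_le_degree _
      simpa using this
    · intro a ha b hb hab
      rw [Finset.mem_coe, Finset.mem_range] at ha hb
      refine Finset.disjoint_left.2 ?_
      intro u hua hub
      have h1 := hdist a (by omega) u hua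
      have h2 := hdist b (by omega) u hub
      omega

/-! ### Truncated voltages and the volume near the source -/

variable [DecidableEq V] {x y : V} {W : V → ℝ}

theorem IsUnitCurrentVoltage.neg (hW : IsUnitCurrentVoltage G x y W) :
    IsUnitCurrentVoltage G y x (fun u => -W u) := by
  intro u
  have := hW u
  have h2 : ∑ v ∈ G.neighborFinset u, (-W u - -W v) = -∑ v ∈ G.neighborFinset u, (W u - W v) := by
    rw [← Finset.sum_neg_distrib]
    exact Finset.sum_congr rfl fun _ _ => by ring
  rw [h2, this]
  ring

/-- A contracted voltage has energy at most the (contracted) voltage drop. -/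
theorem IsUnitCurrentVoltage.energy_comp_le (hW : IsUnitCurrentVoltage G x y W) {φ : ℝ → ℝ}
    (hφ : ∀ s t, (φ s - φ t) ^ 2 ≤ (φ s - φ t) * (s - t)) :
    energy G (fun u => φ (W u)) ≤ 2 * (φ (W x) - φ (W y)) := by
  have h1 : ∑ u, φ (W u) * ∑ v ∈ G.neighborFinset u, (W u - W v) = φ (W x) - φ (W y) := by
    simp_rw [hW _]
    simp [mul_sub, Finset.sum_sub_distrib]
  rw [sum_mul_sum_neighbor_sub] at h1
  have h2 : energy G (fun u => φ (W u)) ≤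
      ∑ u, ∑ v, if G.Adj u v then (φ (W u) - φ (W v)) * (W u - W v) else 0 := by
    refine Finset.sum_le_sum fun u _ => Finset.sum_le_sum fun v _ => ?_
    split_ifs
    · exact hφ _ _
    · rfl
  linarith

/-- Clamping is monotone and 1-Lipschitz, hence admissible in `energy_comp_le`. -/
theorem sq_sub_le_of_clamp (a b s t : ℝ) :
    (max a (min b s) - max a (min b t)) ^ 2 ≤
      (max a (min b s) - max a (min b t)) * (s - t) := by
  have key : ∀ p q : ℝ, p ≤ q → max a (min b p) ≤ max a (min b q) ∧
      max a (min b q) - max a (min b p) ≤ q - p := by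
    intro p q hpq
    refine ⟨by gcongr, ?_⟩
    have h1 : min b q ≤ min b p + (q - p) := by
      rw [← min_add_add_right]
      exact min_le_min (by linarith) (by linarith)
    rcases le_total a (min b q) with h | h
    · rw [max_eq_right h]
      have := le_max_right a (min b p)
      linarith
    · rw [max_eq_left h]
      have := le_max_left a (min b p)
      linarith
  rcases le_total s t with h | h
  · obtain ⟨h1, h2⟩ := key s t h
    nlinarith
  · obtain ⟨h1, h2⟩ := key t s h
    nlinarith

/-- Maximum principle: truncating `W` from below at `W x` leaves zero energy, hence a constant. -/
theorem IsUnitCurrentVoltage.le_source (hG : G.Connected) (hW : IsUnitCurrentVoltage G x y W)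
    (hxy : W y ≤ W x) (u : V) : W u ≤ W x := by
  have h1 := hW.energy_comp_le (φ := fun s => max (W x) s) (by
    intro s t
    rcases le_total (W x) s with h | h <;> rcases le_total (W x) t with h' | h' <;>
      simp only [h, h', max_eq_left, max_eq_right] <;> nlinarith)
  simp only [max_self, max_eq_left hxy, sub_self, mul_zero] at h1
  have h2 := eq_of_energy_eq_zero hG (le_antisymm h1 (energy_nonneg _)) u x
  simp only [max_self] at h2
  exact h2 ▸ le_max_right _ _

/-- No edge carries more than the total current: clamped between `W v` and `W u`, the voltage has
energy at most `2 * (W u - W v)`, while this edge alone contributes `2 * (W u - W v) ^ 2`. -/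
theorem IsUnitCurrentVoltage.sub_le_one (hW : IsUnitCurrentVoltage G x y W) {u v : V}
    (huv : G.Adj u v) : W u - W v ≤ 1 := by
  by_contra! h
  have h1 := hW.energy_comp_le (sq_sub_le_of_clamp (W v) (W u))
  have h2 := sq_sub_le_energy (fun w => max (W v) (min (W u) (W w))) huv
  have hx : max (W v) (min (W u) (W x)) ≤ W u := max_le (by linarith) (min_le_left _ _)
  have hy : W v ≤ max (W v) (min (W u) (W y)) := le_max_left _ _
  simp only [min_self, min_eq_right (show W v ≤ W u by linarith), max_self,
    max_eq_right (show W v ≤ W u by linarith)] at h2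
  nlinarith

theorem IsUnitCurrentVoltage.sub_le_dist (hG : G.Connected) (hW : IsUnitCurrentVoltage G x y W)
    (u v : V) : W u - W v ≤ G.dist u v := by
  obtain ⟨p, hp⟩ := hG.exists_walk_length_eq_dist u v
  rw [← hp]
  clear hp
  induction p with
  | nil => simp
  | cons h p ih =>
    have := hW.sub_le_one h
    rw [SimpleGraph.Walk.length_cons]
    push_cast
    linarith

/-- At least half of the neighbours of the source have a voltage within `2 / d_min` of it. -/
theorem IsUnitCurrentVoltage.volume_neighbors (hG : G.Connected) [Nontrivial V]
    (hW : IsUnitCurrentVoltage G x y W) (hxy : W y < W x) {r : ℝ}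
    (hr : 2 / (G.minDegree : ℝ) ≤ r) :
    (G.minDegree : ℝ) ^ 2 / 2 ≤ volume G {u | W x - r ≤ W u} := by
  classical
  have hδ : (0 : ℝ) < G.minDegree := by
    exact_mod_cast hG.preconnected.minDegree_pos_of_nontrivial
  have hne : x ≠ y := fun h => by simp [h] at hxy
  have hsum := hW x
  rw [if_pos rfl, if_neg hne, sub_zero] at hsum
  set N := G.neighborFinset x with hN
  -- All currents out of `x` are nonnegative and sum to `1`; each bad neighbour takes more than `r`.
  have hbad : ((N.filter fun v => ¬ W x - r ≤ W v).card : ℝ) * r ≤ 1 := by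
    rw [← hsum, ← nsmul_eq_mul]
    calc _ ≤ ∑ v ∈ N.filter fun v => ¬ W x - r ≤ W v, (W x - W v) :=
          Finset.card_nsmul_le_sum _ _ _ fun v hv => by
            have := (Finset.mem_filter.1 hv).2
            linarith
      _ ≤ _ := Finset.sum_le_sum_of_subset_of_nonneg (Finset.filter_subset _ _)
          fun v _ _ => sub_nonneg.2 (hW.le_source hG hxy.le v)
  have hsplit : ((N.filter fun v => W x - r ≤ W v).card : ℝ) +
      ((N.filter fun v => ¬ W x - r ≤ W v).card : ℝ) = G.degree x := by
    rw [← SimpleGraph.card_neighborFinset_eq_degree, ← hN]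
    exact_mod_cast Finset.card_filter_add_card_filter_not _
  have hdeg : (G.minDegree : ℝ) ≤ G.degree x := by exact_mod_cast G.minDegree_le_degree x
  have hvol := card_mul_minDegree_le_volume (G := G) (A := {u | W x - r ≤ W u})
    (N.filter fun v => W x - r ≤ W v) fun u hu => (Finset.mem_filter.1 hu).2
  rw [div_le_iff₀ hδ] at hr
  have hbad2 : 2 * ((N.filter fun v => ¬ W x - r ≤ W v).card : ℝ) ≤ G.minDegree := by
    have h0 : (0 : ℝ) ≤ ((N.filter fun v => ¬ W x - r ≤ W v).card : ℝ) := by positivity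
    nlinarith [mul_le_mul_of_nonneg_left hr h0]
  nlinarith

theorem IsUnitCurrentVoltage.le_volume (hG : G.Connected) [Nontrivial V]
    (hW : IsUnitCurrentVoltage G x y W) {r : ℝ} (hxy : r < W x - W y)
    (hr : 2 / (G.minDegree : ℝ) ≤ r) :
    r * (G.minDegree : ℝ) ^ 2 / 6 ≤ volume G {u | W x - r ≤ W u} := by
  have hr0 : 0 ≤ r := le_trans (by positivity) hr
  rcases lt_or_ge r 1 with h1 | h1
  · refine le_trans ?_ (hW.volume_neighbors hG (by linarith) hr)
    nlinarith [sq_nonneg (G.minDegree : ℝ)]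
  · have hk := Nat.floor_le hr0
    have hk' := Nat.lt_floor_add_one r
    have hk1 : 1 ≤ ⌊r⌋₊ := Nat.one_le_floor_iff _ |>.2 h1
    set k := ⌊r⌋₊
    have hfar : k ≤ G.dist x y := by
      have := hW.sub_le_dist hG x y
      have h2 : (k : ℝ) ≤ G.dist x y := by linarith
      exact_mod_cast h2
    -- With `j = (k - 1) / 3`, the radius `3 * j + 1` is at most `k`, and `k ≤ 3 * (j + 1)`.
    obtain ⟨S, hS, hcard⟩ := exists_finset_dist_le hG (x := x) (y := y) ((k - 1) / 3) (by omega)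
    have hvol := card_mul_minDegree_le_volume (G := G) (A := {u | W x - r ≤ W u}) S fun u hu => by
      have h2 : G.dist x u ≤ k := (hS u hu).trans (by omega)
      have h3 : (G.dist x u : ℝ) ≤ k := by exact_mod_cast h2
      have := hW.sub_le_dist hG x u
      rw [Set.mem_ofPred_eq]
      linarith
    have h4 : k * G.minDegree ≤ 3 * S.card :=
      (Nat.mul_le_mul_right _ (show k ≤ 3 * ((k - 1) / 3 + 1) by omega)).trans (by
        rw [mul_assoc]
        exact Nat.mul_le_mul_left _ hcard)
    have h5 : (k : ℝ) * G.minDegree ≤ 3 * S.card := by exact_mod_cast h4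
    have h6 : r ≤ 2 * k := by
      have : (1 : ℝ) ≤ k := by exact_mod_cast hk1
      linarith
    have hδ : (0 : ℝ) ≤ G.minDegree := by positivity
    nlinarith [mul_le_mul_of_nonneg_right h5 hδ,
      mul_le_mul_of_nonneg_right h6 (sq_nonneg (G.minDegree : ℝ))]

/-! ### The resistance bound -/

theorem one_le_relaxationTime (hG : G.Connected) [Nontrivial V] : 1 ≤ relaxationTime G := by
  obtain ⟨h0, h1, -⟩ := poincare_of_sum_eq_zero hG
  exact (one_le_inv₀ (by linarith)).2 (by linarith)

/-- The bound on the voltage drop when at least half of the volume lies below the middle level. -/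
theorem IsUnitCurrentVoltage.drop_le_of_volume_le (hG : G.Connected) [Nontrivial V]
    (hW : IsUnitCurrentVoltage G x y W)
    (hvol : volume G {u | (W x + W y) / 2 < W u} ≤ volume G {u | W u ≤ (W x + W y) / 2}) :
    W x - W y ≤ 10 * √(relaxationTime G) / (G.minDegree : ℝ) := by
  have hδ : (0 : ℝ) < G.minDegree := by
    exact_mod_cast hG.preconnected.minDegree_pos_of_nontrivial
  have hT := one_le_relaxationTime hG
  rw [le_div_iff₀ hδ]
  rcases lt_or_ge ((W x - W y) / 4) (2 / (G.minDegree : ℝ)) with hsmall | hlarge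
  · rw [lt_div_iff₀ hδ] at hsmall
    have := Real.one_le_sqrt.2 hT
    linarith
  · set r := (W x - W y) / 4 with hrdef
    set c := (W x + W y) / 2 with hcdef
    have hr0 : 0 < r := lt_of_lt_of_le (by positivity) hlarge
    have hA := hW.le_volume hG (r := r) (by linarith) hlarge
    have hAB : volume G {u | W x - r ≤ W u} ≤ volume G {u | W u ≤ c} :=
      (volume_mono fun u (hu : W x - r ≤ W u) => show c < W u by linarith).trans hvol
    -- Since `W x - r - c = r`, this function ranges over `[0, r]`.
    have hE := hW.energy_comp_le (φ := fun s => max c (min (W x - r) s) - c) fun s t => by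
      have := sq_sub_le_of_clamp c (W x - r) s t
      simpa only [sub_sub_sub_cancel_right] using this
    have hdrop : (max c (min (W x - r) (W x)) - c) - (max c (min (W x - r) (W y)) - c) ≤ r := by
      have h1 : max c (min (W x - r) (W x)) ≤ W x - r :=
        max_le (by linarith) (min_le_left _ _)
      have h2 := le_max_left c (min (W x - r) (W y))
      linarith
    have hP := poincare_two_sets hG (f := fun u => max c (min (W x - r) (W u)) - c) hr0
      (A := {u | W x - r ≤ W u}) (B := {u | W u ≤ c})
      (fun u (hu : W x - r ≤ W u) => by
        rw [min_eq_left hu]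
        have := le_max_right c (W x - r)
        linarith)
      (fun u (hu : W u ≤ c) => by
        have : max c (min (W x - r) (W u)) ≤ c := max_le le_rfl ((min_le_right _ _).trans hu)
        linarith) hAB
    obtain ⟨-, hgap, -⟩ := poincare_of_sum_eq_zero hG
    have hgap' : 0 < 1 - secondEigenvalue G := by linarith
    have hMr : (1 - secondEigenvalue G) * (volume G {u | W x - r ≤ W u} * r) ≤ 1 := by
      refine le_of_mul_le_mul_right ?_ hr0
      linarith
    have hMr' : volume G {u | W x - r ≤ W u} * r ≤ relaxationTime G := by
      rw [relaxationTime, ← one_div, le_div_iff₀ hgap']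
      linarith
    have hsq : (r * G.minDegree) ^ 2 ≤ 6 * relaxationTime G := by
      nlinarith [mul_le_mul_of_nonneg_right hA hr0.le]
    have hsqrt := Real.sq_sqrt (zero_le_one.trans hT)
    -- Here `6 ≤ (5 / 2) ^ 2`; the final constant is `4 * (5 / 2) = 10`.
    have hfin : r * G.minDegree ≤ 5 / 2 * √(relaxationTime G) := by
      refine abs_le_of_sq_le_sq' ?_ (by positivity) |>.2
      rw [mul_pow (5 / 2 : ℝ), hsqrt]
      linarith
    have : W x - W y = 4 * r := by rw [hrdef]; ring
    rw [this]
    linarith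

theorem effectiveResistance_le (hG : G.Connected) [Nontrivial V] (x y : V) :
    effectiveResistance hG x y ≤ 10 * √(relaxationTime G) / (G.minDegree : ℝ) := by
  obtain ⟨W, hW⟩ := exists_isUnitCurrentVoltage hG x y
  rw [effectiveResistance_eq hG hW]
  rcases le_total (volume G {u | (W x + W y) / 2 < W u}) (volume G {u | W u ≤ (W x + W y) / 2})
    with h | h
  · exact hW.drop_le_of_volume_le hG h
  · have h2 := hW.neg.drop_le_of_volume_le hG ?_
    · linarith
    · refine (volume_mono fun u hu => ?_).trans (h.trans (volume_mono fun u hu => ?_))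
      · simp only [Set.mem_ofPred_eq] at hu ⊢
        linarith
      · simp only [Set.mem_ofPred_eq] at hu ⊢
        linarith

end LazyWalk

theorem mainTheorem5 :
    ∃ K : ℝ, 0 < K ∧
      ∀ (V : Type*) [Fintype V] [DecidableEq V] [Nontrivial V]
        (G : SimpleGraph V) [DecidableRel G.Adj] (hG : G.Connected) (x y : V),
        LazyWalk.effectiveResistance hG x y ≤
          K * Real.sqrt (LazyWalk.relaxationTime G) / (G.minDegree : ℝ) :=
  ⟨10, by norm_num, fun _ _ _ _ _ _ hG x y => LazyWalk.effectiveResistance_le hG x y⟩
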